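/- **Conventions.** A mass problem is a set $\mathcal{X}\subseteq\omega^\omega$. For $f,g\in\omega^\omega$ let $f\oplus g$ be given by $(f\oplus g)(2n)=f(n)$ and $(f\oplus g)(2n+1)=g(n)$, and let $\mathcal{X}\oplus\mathcal{Y}=\{f\oplus g\mid f\in\mathcal{X},g\in\mathcal{Y}\}$. Write $\mathcal{X}\le_{\mathcal{M}}\mathcal{Y}$ if there is a partial Turing functional $\Phi$ with $\Phi(\mathcal{Y})\subseteq\mathcal{X}$, and, for families indexed by a set $X$ of (codes of) tuples of natural numbers, $(\mathcal{X}_i)_{i\in X}\le(\mathcal{Y}_i)_{i\in X}$ if there is one partial Turing functional $\Phi$ with $\Phi(i^\frown\mathcal{Y}_i)\subseteq\mathcal{X}_i$ for all $i\in X$ (for finite $X$ this is coordinatewise $\le_{\mathcal{M}}$). Families are identified if each reduces to the other. **Intervals.** Let $\mathcal{A}$ and $\mathcal{B}_i$ $(i\ge -1)$ be mass problems with $(\mathcal{A},\mathcal{A},\dots)\ge(\mathcal{B}_i)_{i\in\omega}\ge(\mathcal{B}_{-1},\mathcal{B}_{-1},\dots)$ and $\mathcal{B}_i\not\ge_{\mathcal{M}}\mathcal{A}$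 for all $i\ge-1$. Put $\mathcal{B}_{(y_1,\dots,y_n)}=\mathcal{B}_{y_1}\oplus\dots\oplus\mathcal{B}_{y_n}$, and $\mathcal{B}_{()}=\mathcal{B}_{-1}$. The interval $\mathbb{P}=[(\mathcal{B}_i)_{i\ge-1},\mathcal{A}]_{\mathbb{P}_{\mathcal{M}}}$ has as objects the sets $\{1,\dots,m\}^n$ (with $m\geq 1$) and $\omega^n$, and as morphisms $\alpha:X\to Y$ the computable functions with $(\mathcal{B}_x)_{x\in X}\ge(\mathcal{B}_{\alpha(x)})_{x\in X}$. It assigns to $X$ the Brouwer algebra $\mathbb{P}(X)$ of all families $(\mathcal{C}_x)_{x\in X}$ with $(\mathcal{B}_x)_{x\in X}\le(\mathcal{C}_x)_{x\in X}\le(\mathcal{A})_{x\in X}$, and to $\alpha:X\to Y$ the map $\alpha^*:\mathbb{P}(Y)\to\mathbb{P}(X)$, $\alpha^*(\mathcal{C})_x=\mathcal{C}_{\alpha(x)}\oplus\mathcal{B}_x$. **Structures.** A structure $\mathfrak{M}$ in $\mathbb{P}$ for the language with one unary relation symbol $S$ consists of an object $M$ and an element $[\![S]\!]\in\mathbb{P}(M)$.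 A formula $\varphi$ in a context of $n$ variables is interpreted as an element $[\![\varphi]\!]\in\mathbb{P}(M^n)$: $S(x_i)$ is interpreted by the pullback of $[\![S]\!]$ along the $i$-th projection, $\bot$ by the largest element, $\vee$ by the meet, $\wedge$ by the join $\oplus$, $\to$ by the implication of the Brouwer algebra ($c=a\to b$ is the element with $c\le y\iff b\le a\oplus y$ for all $y$), $\neg\varphi$ by $\varphi\to\bot$, and, with $\pi:M^n\times M\to M^n$ the projection, $\forall$ and $\exists$ by the left and right adjoint of $\pi^*$: $[\![\forall y\,\psi]\!]\le d\iff[\![\psi]\!]\le\pi^*(d)$ and $d\le[\![\exists y\,\psi]\!]\iff\pi^*(d)\le[\![\psi]\!]$ for all $d\in\mathbb{P}(M^n)$. The structure refutes a sentence if the interpretation of that sentence is not the least element of $\mathbb{P}(M^0)$. **Proposition.** There are an interval $[(\mathcal{B}_i)_{i\ge-1},\mathcal{A}]_{\mathbb{P}_{\mathcal{M}}}$ and a structure $\mathfrak{M}$ in it for the language with one unary relation symbol $S$ such that $\mathfrak{M}$ refutes the sentence $$\bigl(\forall x\,(S(x)\vee\neg S(x))\wedge\neg\forall x\,\neg S(x)\bigr)\to\exists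 x\,\neg\neg S(x).$$ -/

import Mathlib

namespace MassProb

/-! ### Turing functionals and reducibility of mass problems -/

/-- Codes for partial recursive functionals: the usual generators of the partial recursive
functions together with an instruction that queries the oracle. -/
inductive OracleCode : Type
  | zero : OracleCode
  | succ : OracleCode
  | left : OracleCode
  | right : OracleCode
  | oracle : OracleCode
  | pair : OracleCode → OracleCode → OracleCode
  | comp : OracleCode → OracleCode → OracleCode
  | prec : OracleCode → OracleCode → OracleCode
  | rfind : OracleCode → OracleCode

/-- The partial function computed by a code with oracle `g`; the clauses are those of
`Nat.RecursiveIn {g}`. -/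
def OracleCode.eval (g : ℕ → ℕ) : OracleCode → ℕ →. ℕ
  | .zero => fun _ => Part.some 0
  | .succ => fun n => Part.some (n + 1)
  | .left => fun n => Part.some n.unpair.1
  | .right => fun n => Part.some n.unpair.2
  | .oracle => fun n => Part.some (g n)
  | .pair a b => fun n => Nat.pair <$> eval g a n <*> eval g b n
  | .comp a b => fun n => eval g b n >>= eval g a
  | .prec a b => fun p =>
      p.unpair.2.rec (eval g a p.unpair.1) fun y IH => do
        let i ← IH
        eval g b (Nat.pair p.unpair.1 (Nat.pair y i))
  | .rfind a => fun p => Nat.rfind fun n => (fun m => decide (m = 0)) <$> eval g a (Nat.pair p n)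

/-- The Turing functional `Φ` with code `c` is defined at `g`, and `Φ(g) = f`. -/
def OracleCode.Maps (c : OracleCode) (g f : ℕ → ℕ) : Prop := ∀ n, f n ∈ c.eval g n

/-- A mass problem: a set of functions from `ω` to `ω`. -/
abbrev MassProblem : Type := Set (ℕ → ℕ)

/-- The sequence `n ⌢ g`. -/
def cons (n : ℕ) (g : ℕ → ℕ) : ℕ → ℕ
  | 0 => n
  | k + 1 => g k

/-- The join `f ⊕ g`: `f` on the even and `g` on the odd numbers. -/
def joinFun (f g : ℕ → ℕ) : ℕ → ℕ := fun n => if n % 2 = 0 then f (n / 2) else g (n / 2)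

/-- The join of two mass problems. -/
def join (A B : MassProblem) : MassProblem := {h | ∃ f ∈ A, ∃ g ∈ B, h = joinFun f g}

/-- Medvedev reducibility: one Turing functional sends every element of `B` into `A`. -/
def MedvedevLE (A B : MassProblem) : Prop :=
  ∃ c : OracleCode, ∀ g ∈ B, ∃ f ∈ A, c.Maps g f

/-- Uniform reducibility of families whose index set is coded by natural numbers: there is one
Turing functional `Φ` with `Φ(code i ⌢ B i) ⊆ A i` for all `i`. -/
def UniformLE {ι : Type} (code : ι → ℕ) (A B : ι → MassProblem) : Prop :=
  ∃ c : OracleCode, ∀ i, ∀ g ∈ B i, ∃ f ∈ A i, c.Maps (cons (code i) g) f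

/-- Reducibility of `ω`-mass problems. -/
def OmegaLE (A B : ℕ → MassProblem) : Prop := UniformLE id A B

/-! These reducibilities are preorders. -/

def OracleCode.ident : OracleCode := .pair .left .right

lemma OracleCode.eval_ident (g : ℕ → ℕ) (n : ℕ) : ident.eval g n = Part.some n := by
  simp [ident, eval, Seq.seq]

/-- Replace the oracle by the function computed by `d`. -/
def OracleCode.subst (d : OracleCode) : OracleCode → OracleCode
  | .zero => .zero
  | .succ => .succ
  | .left => .left
  | .right => .right
  | .oracle => d
  | .pair a b => .pair (subst d a) (subst d b)
  | .comp a b => .comp (subst d a) (subst d b)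
  | .prec a b => .prec (subst d a) (subst d b)
  | .rfind a => .rfind (subst d a)

lemma OracleCode.eval_subst {g f : ℕ → ℕ} {d : OracleCode} (h : d.Maps g f) (c : OracleCode) :
    (subst d c).eval g = c.eval f := by
  induction c with
  | oracle =>
    funext n
    exact Part.eq_some_iff.mpr (h n)
  | zero | succ | left | right => rfl
  | pair a b iha ihb => simp only [subst, eval, iha, ihb]; rfl
  | comp a b iha ihb => simp only [subst, eval, iha, ihb]; rfl
  | prec a b iha ihb => simp only [subst, eval, iha, ihb]; rfl
  | rfind a iha => simp only [subst, eval, iha]; rfl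

/-- A code that sends `n ⌢ g` to `n ⌢ Φ(n ⌢ g)`, where `c` is a code of `Φ`. -/
def OracleCode.keepHead (c : OracleCode) : OracleCode :=
  .comp (.prec (.comp .oracle .zero) (.comp c (.comp .left .right))) (.pair .zero ident)

lemma OracleCode.keepHead_maps {c : OracleCode} {n : ℕ} {g f : ℕ → ℕ} (h : c.Maps (cons n g) f) :
    c.keepHead.Maps (cons n g) (cons n f) := by
  intro k
  have key : ∀ k, (OracleCode.prec (.comp .oracle .zero) (.comp c (.comp .left .right))).eval
      (cons n g) (Nat.pair 0 k) = Part.some (cons n f k) := by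
    intro k
    induction k with
    | zero => simp [eval, cons]
    | succ k ih =>
      simp only [eval, Nat.unpair_pair] at ih ⊢
      rw [ih]
      have := Part.eq_some_iff.mpr (h k)
      simp only [Part.bind_eq_bind, Part.bind_some, Nat.unpair_pair]
      exact (Part.bind_some k _).trans this
  have h2 : (OracleCode.pair .zero ident).eval (cons n g) k = Part.some (Nat.pair 0 k) := by
    have := eval_ident (cons n g) k
    simp [eval, this, Seq.seq]
  have h3 : c.keepHead.eval (cons n g) k = Part.some (cons n f k) := by
    show (OracleCode.pair .zero ident).eval (cons n g) k >>= _ = _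
    rw [h2]
    exact (Part.bind_some _ _).trans (key k)
  rw [h3]
  exact Part.mem_some _

lemma MedvedevLE.refl (A : MassProblem) : MedvedevLE A A :=
  ⟨.oracle, fun g hg => ⟨g, hg, fun _ => Part.mem_some _⟩⟩

lemma MedvedevLE.trans {A B C : MassProblem} (h₁ : MedvedevLE A B) (h₂ : MedvedevLE B C) :
    MedvedevLE A C := by
  obtain ⟨c, hc⟩ := h₁
  obtain ⟨d, hd⟩ := h₂
  refine ⟨OracleCode.subst d c, fun g hg => ?_⟩
  obtain ⟨f, hf, hdf⟩ := hd g hg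
  obtain ⟨e, he, hce⟩ := hc f hf
  exact ⟨e, he, fun n => by rw [OracleCode.eval_subst hdf]; exact hce n⟩

lemma UniformLE.refl {ι : Type} (code : ι → ℕ) (A : ι → MassProblem) : UniformLE code A A :=
  ⟨.comp .oracle .succ, fun i g hg => ⟨g, hg, fun n => by simp [OracleCode.eval, cons]⟩⟩

lemma UniformLE.trans {ι : Type} {code : ι → ℕ} {A B C : ι → MassProblem}
    (h₁ : UniformLE code A B) (h₂ : UniformLE code B C) : UniformLE code A C := by
  obtain ⟨c, hc⟩ := h₁
  obtain ⟨d, hd⟩ := h₂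
  refine ⟨OracleCode.subst d.keepHead c, fun i g hg => ?_⟩
  obtain ⟨f, hf, hdf⟩ := hd i g hg
  obtain ⟨e, he, hce⟩ := hc i f hf
  refine ⟨e, he, fun n => ?_⟩
  rw [OracleCode.eval_subst (OracleCode.keepHead_maps hdf)]
  exact hce n

/-! ### The base category -/

/-- The two kinds of basic sets: `finite m` is `{1, …, m + 1}`, and `omega` is `ω`. -/
inductive Base : Type
  | finite : ℕ → Base
  | omega : Base

/-- The elements of a basic set; `i : Fin (m + 1)` stands for the number `i + 1`. -/
def Base.Carrier : Base → Type
  | .finite m => Fin (m + 1)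
  | .omega => ℕ

/-- The natural number that an element of a basic set stands for. -/
def Base.toNat : (b : Base) → b.Carrier → ℕ
  | .finite _, i => i.val + 1
  | .omega, i => i

/-- The objects `{1, …, m}ⁿ` and `ωⁿ` of the base category. -/
structure Obj : Type where
  base : Base
  exp : ℕ

/-- The points of an object are tuples. -/
def Obj.Pt (X : Obj) : Type := Fin X.exp → X.base.Carrier

/-- A computable coding of `n`-tuples of natural numbers, bijective for `n ≥ 1`. -/
def tupleCode : (n : ℕ) → (Fin n → ℕ) → ℕ
  | 0, _ => 0
  | 1, a => a 0
  | n + 2, a => Nat.pair (a 0) (tupleCode (n + 1) fun i => a i.succ)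

/-- The code of a point. -/
def Obj.code (X : Obj) (p : X.Pt) : ℕ := tupleCode X.exp fun i => X.base.toNat (p i)

/-- The `n`-fold product of `X` with itself. -/
def Obj.pow (X : Obj) (n : ℕ) : Obj := ⟨X.base, n * X.exp⟩

/-- The point of `Xⁿ` with given components in `X`. -/
def Obj.tuple (X : Obj) {n : ℕ} (a : Fin n → X.Pt) : (X.pow n).Pt :=
  fun i => a (finProdFinEquiv.symm i).1 (finProdFinEquiv.symm i).2

/-- The `i`-th projection from `Xⁿ` to `X`. -/
def Obj.proj (X : Obj) {n : ℕ} (p : (X.pow n).Pt) (i : Fin n) : X.Pt :=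
  fun j => p (finProdFinEquiv (i, j))

/-- The projection from `Xⁿ⁺¹ = Xⁿ × X` to `Xⁿ`. -/
def Obj.dropLast (X : Obj) (n : ℕ) (p : (X.pow (n + 1)).Pt) : (X.pow n).Pt :=
  X.tuple fun i => X.proj p i.castSucc

/-- The diagonal from `X` to `X × X`. -/
def Obj.diag (X : Obj) (p : X.Pt) : (X.pow 2).Pt := X.tuple ![p, p]

/-- A function between objects is computable (for finite sets this always holds). -/
def IsComputable {X Y : Obj} (α : X.Pt → Y.Pt) : Prop :=
  ∃ g : ℕ → ℕ, Computable g ∧ ∀ p, Y.code (α p) = g (X.code p)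

/-- Families of mass problems indexed by the points of `X`. They represent the elements of the
poset that the hyperdoctrine of mass problems assigns to `X`; two of them represent the same
element if each reduces to the other. -/
def Obj.Fam (X : Obj) : Type := X.Pt → MassProblem

/-- The order: coordinatewise Medvedev reducibility over a finite set, and reducibility of
`ω`-mass problems over a power of `ω`. -/
def Obj.Fam.Reduces {X : Obj} (C D : X.Fam) : Prop :=
  match X.base with
  | .finite _ => ∀ p, MedvedevLE (C p) (D p)
  | .omega => UniformLE X.code C D

instance (X : Obj) : Preorder X.Fam where
  le := Obj.Fam.Reduces
  le_refl C := by
    obtain ⟨b, n⟩ := X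
    cases b with
    | finite m => exact fun p => MedvedevLE.refl _
    | omega => exact UniformLE.refl _ _
  le_trans C D E h₁ h₂ := by
    obtain ⟨b, n⟩ := X
    cases b with
    | finite m => exact fun p => MedvedevLE.trans (h₁ p) (h₂ p)
    | omega => exact UniformLE.trans h₁ h₂

/-- The coordinatewise join of families. -/
def Obj.Fam.join {X : Obj} (C D : X.Fam) : X.Fam := fun p => MassProb.join (C p) (D p)

/-! ### General intervals of the hyperdoctrine of mass problems -/

/-- The data of an interval: `A`, `B₋₁` (called `B0`) and `B i` for `i ≥ 0`, with the conditions
`(A, A, …) ≥ (B i)ᵢ ≥ (B₋₁, B₋₁, …)` in the degrees of `ω`-mass problems and `B i ≱ A` in the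
Medvedev degrees for all `i ≥ -1`. -/
structure Interval : Type where
  A : MassProblem
  B0 : MassProblem
  B : ℕ → MassProblem
  B_le_A : OmegaLE B fun _ => A
  B0_le_B : OmegaLE (fun _ => B0) B
  B0_not_ge : ¬ MedvedevLE A B0
  B_not_ge : ∀ i, ¬ MedvedevLE A (B i)

/-- `B_{y₁} ⊕ (B_{y₂} ⊕ ⋯ (B_{yₙ} ⊕ B₋₁))`. As every `B i` uniformly computes an element of
`B₋₁`, this is `B_{y₁} ⊕ ⋯ ⊕ B_{yₙ}` for `n ≥ 1`; the empty tuple gets `B₋₁`. -/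
def Interval.bottomAt (I : Interval) : (n : ℕ) → (Fin n → ℕ) → MassProblem
  | 0, _ => I.B0
  | n + 1, y => MassProb.join (I.B (y 0)) (I.bottomAt n fun i => y i.succ)

/-- The bottom family `(B_y)_{y ∈ X}`. -/
def Interval.bottom (I : Interval) (X : Obj) : X.Fam :=
  fun p => I.bottomAt X.exp fun i => X.base.toNat (p i)

/-- The top family `(A, A, …)`. -/
def Interval.top (I : Interval) (X : Obj) : X.Fam := fun _ => I.A

/-- The poset (represented as a preorder) that the interval assigns to the object `X`. -/
abbrev Interval.Pred (I : Interval) (X : Obj) : Type :=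
  {C : X.Fam // I.bottom X ≤ C ∧ C ≤ I.top X}

/-- The action of a function `α : X → Y` on families: `C ↦ (C_{α p} ⊕ B_p)_{p ∈ X}`. -/
def Interval.pull (I : Interval) {X Y : Obj} (α : X.Pt → Y.Pt) (C : Y.Fam) : X.Fam :=
  Obj.Fam.join (fun p => C (α p)) (I.bottom X)

/-- Morphisms of the base category: the computable functions `α` for which `B_y` computes
`B_{α y}`, uniformly in `y`. -/
def Interval.IsMorphism (I : Interval) {X Y : Obj} (α : X.Pt → Y.Pt) : Prop :=
  IsComputable α ∧ (show X.Fam from fun p => I.bottom Y (α p)) ≤ I.bottom X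

/-! ### First-order formulas, structures and their interpretation -/

/-- First-order formulas in the context `x₀, …, xₙ₋₁`; a quantifier binds the last variable of
the enlarged context. -/
inductive Formula (L : FirstOrder.Language.{0, 0}) : ℕ → Type
  | verum {n : ℕ} : Formula L n
  | falsum {n : ℕ} : Formula L n
  | eq {n : ℕ} (t s : L.Term (Fin n)) : Formula L n
  | rel {n m : ℕ} (R : L.Relations m) (ts : Fin m → L.Term (Fin n)) : Formula L n
  | and {n : ℕ} (φ ψ : Formula L n) : Formula L n
  | or {n : ℕ} (φ ψ : Formula L n) : Formula L n
  | imp {n : ℕ} (φ ψ : Formula L n) : Formula L n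
  | ex {n : ℕ} (φ : Formula L (n + 1)) : Formula L n
  | all {n : ℕ} (φ : Formula L (n + 1)) : Formula L n

/-- Negation. -/
def Formula.neg {L : FirstOrder.Language.{0, 0}} {n : ℕ} (φ : Formula L n) : Formula L n :=
  .imp φ .falsum

/-- A structure for `L` in the interval `I`: a universe, a morphism `Mⁿ → M` for every `n`-ary
function symbol and an element of the algebra of `Mⁿ` for every `n`-ary relation symbol. -/
structure Struct (I : Interval) (L : FirstOrder.Language.{0, 0}) : Type where
  univ : Obj
  fn : {n : ℕ} → L.Functions n → (univ.pow n).Pt → univ.Pt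
  fn_morphism : ∀ {n : ℕ} (f : L.Functions n), I.IsMorphism (fn f)
  rel : {n : ℕ} → L.Relations n → I.Pred (univ.pow n)

namespace Struct

variable {I : Interval} {L : FirstOrder.Language.{0, 0}} (M : Struct I L)

/-- The interpretation of a term as a function `Mⁿ → M`. -/
def termVal {n : ℕ} (p : (M.univ.pow n).Pt) : L.Term (Fin n) → M.univ.Pt
  | .var i => M.univ.proj p i
  | .func f ts => M.fn f (M.univ.tuple fun i => termVal p (ts i))

/-- `E` is the equality predicate of the universe: the value of the right adjoint of the pullback
along the diagonal at the bottom element. -/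
def IsEquality (E : I.Pred (M.univ.pow 2)) : Prop :=
  ∀ C : I.Pred (M.univ.pow 2), I.pull M.univ.diag C.1 ≤ I.bottom M.univ ↔ C ≤ E

/-- `M.Interprets φ c` says that `c` represents the interpretation of `φ` in the algebra of `Mⁿ`.
Every connective and quantifier is given by its universal property in a first-order hyperdoctrine
of Brouwer algebras (disjunction is meet, conjunction is join, and `c = a → b` means that
`c ≤ y` iff `b ≤ a ⊕ y`), so that `c` is determined up to equivalence. -/
def Interprets : {n : ℕ} → Formula L n → I.Pred (M.univ.pow n) → Prop
  | _, .verum, c => IsBot c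
  | _, .falsum, c => IsTop c
  | _, .eq t s, c => ∃ E : I.Pred (M.univ.pow 2), M.IsEquality E ∧
      AntisymmRel (· ≤ ·) c.1 (I.pull (fun p => M.univ.tuple ![M.termVal p t, M.termVal p s]) E.1)
  | _, .rel R ts, c =>
      AntisymmRel (· ≤ ·) c.1
        (I.pull (fun p => M.univ.tuple fun i => M.termVal p (ts i)) (M.rel R).1)
  | _, .and φ ψ, c => ∃ a b, Interprets φ a ∧ Interprets ψ b ∧ IsLUB {a, b} c
  | _, .or φ ψ, c => ∃ a b, Interprets φ a ∧ Interprets ψ b ∧ IsGLB {a, b} c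
  | n, .imp φ ψ, c => ∃ a b, Interprets φ a ∧ Interprets ψ b ∧
      ∀ y : I.Pred (M.univ.pow n), c ≤ y ↔ b.1 ≤ a.1.join y.1
  | n, .ex φ, c => ∃ a, Interprets φ a ∧
      ∀ d : I.Pred (M.univ.pow n), d ≤ c ↔ I.pull (M.univ.dropLast n) d.1 ≤ a.1
  | n, .all φ, c => ∃ a, Interprets φ a ∧
      ∀ d : I.Pred (M.univ.pow n), c ≤ d ↔ a.1 ≤ I.pull (M.univ.dropLast n) d.1

/-- `M` refutes the sentence `φ`: the interpretation of `φ` exists, and it is not the bottom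
element, that is, `φ` is not in the theory of `M`. -/
def Refutes (φ : Formula L 0) : Prop :=
  (∃ c, M.Interprets φ c) ∧ ∀ c, M.Interprets φ c → ¬ IsBot c

end Struct

/-! ### The formula -/

/-- The relation symbols of the language: one unary symbol `S`. -/
inductive UnaryRel : ℕ → Type
  | S : UnaryRel 1

/-- The language with one unary relation symbol and no function symbols. -/
def unaryLang : FirstOrder.Language.{0, 0} := ⟨fun _ => Empty, UnaryRel⟩

/-- The formula `S(x)` in the context `x`. -/
def formulaS : Formula unaryLang 1 := .rel UnaryRel.S fun _ => .var 0

/-- The sentence `(∀x (S(x) ∨ ¬S(x)) ∧ ¬∀x ¬S(x)) → ∃x ¬¬S(x)`. -/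
def markovSentence : Formula unaryLang 0 :=
  .imp (.and (.all (.or formulaS formulaS.neg)) (Formula.neg (.all formulaS.neg)))
    (.ex formulaS.neg.neg)

end MassProb

namespace MassProb

/-! ### Oracle codes -/

/-! The universe `{1}` has only one element, yet the least element of the algebra grows from `{1}⁰`
to `{1}`, and this alone defeats the existential quantifier. Fix a noncomputable `f` and let `B₋₁`
be all functions, every `B i` the noncomputable functions, and `A` the functions not computable from
`f`. Interpret `S` by the least element.

Every least element has a solution computable from `f`, so joining it to a problem never helps to
solve `A` (`notBelow_medvedevLE_of_join`, `top_le_of_le_join`). Hence `¬S` and `∀x ¬S` are largest,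
while `¬¬S`, `S ∨ ¬S` and both conjuncts of the premise are least. The sentence thus has the same
value as its conclusion. As `∃` is a right adjoint, that value is the greatest `d` with `d ⊕ B₁ ≤
B₁`, namely the degree of `B₁` itself (`interprets_ex_iff`). In the algebra of `{1}⁰` the least
element is `B₋₁`, which has a computable member, so `B₁` is not least there (`not_isBot_bottomOne`).

Interpretations are determined only up to equivalence, so each subformula gets an equivalence
describing all its interpretations; this yields both halves of `Refutes`. -/

/-- Every partial recursive function has a code that does not depend on the oracle. -/
lemma OracleCode.exists_of_partrec {f : ℕ →. ℕ} (hf : Nat.Partrec f) :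
    ∃ c : OracleCode, ∀ g, c.eval g = f := by
  induction hf with
  | zero => exact ⟨.zero, fun _ => rfl⟩
  | succ => exact ⟨.succ, fun _ => rfl⟩
  | left => exact ⟨.left, fun _ => rfl⟩
  | right => exact ⟨.right, fun _ => rfl⟩
  | pair _ _ iha ihb =>
    obtain ⟨a, ha⟩ := iha
    obtain ⟨b, hb⟩ := ihb
    exact ⟨.pair a b, fun g => by simp only [eval, ha, hb]; rfl⟩
  | comp _ _ iha ihb =>
    obtain ⟨a, ha⟩ := iha
    obtain ⟨b, hb⟩ := ihb
    exact ⟨.comp a b, fun g => by simp only [eval, ha, hb]; rfl⟩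
  | prec _ _ iha ihb =>
    obtain ⟨a, ha⟩ := iha
    obtain ⟨b, hb⟩ := ihb
    exact ⟨.prec a b, fun g => by simp only [eval, ha, hb]; rfl⟩
  | rfind _ iha =>
    obtain ⟨a, ha⟩ := iha
    exact ⟨.rfind a, fun g => by simp only [eval, ha]; rfl⟩

lemma OracleCode.exists_of_computable {f : ℕ → ℕ} (hf : Computable f) :
    ∃ c : OracleCode, ∀ g n, c.eval g n = Part.some (f n) := by
  obtain ⟨c, hc⟩ := exists_of_partrec (Partrec.nat_iff.mp hf)
  exact ⟨c, fun g n => by rw [hc]; rfl⟩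

lemma OracleCode.eval_comp {a b : OracleCode} {g : ℕ → ℕ} {n m : ℕ}
    (h : b.eval g n = Part.some m) : (comp a b).eval g n = a.eval g m := by
  simp only [eval, h]
  exact Part.bind_some _ _

lemma OracleCode.eval_pair {a b : OracleCode} {g : ℕ → ℕ} {n x y : ℕ}
    (ha : a.eval g n = Part.some x) (hb : b.eval g n = Part.some y) :
    (pair a b).eval g n = Part.some (Nat.pair x y) := by
  simp [eval, ha, hb, Seq.seq]

/-- An injective numbering of the oracle codes. -/
def OracleCode.number : OracleCode → ℕ
  | .zero => 0
  | .succ => 1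
  | .left => 2
  | .right => 3
  | .oracle => 4
  | .pair a b => 4 * Nat.pair a.number b.number + 5
  | .comp a b => 4 * Nat.pair a.number b.number + 6
  | .prec a b => 4 * Nat.pair a.number b.number + 7
  | .rfind a => 4 * a.number + 8

/-- Numbers below 5 are the atomic codes; from 5 on, the residue modulo 4 determines the
constructor. -/
lemma OracleCode.number_injective : Function.Injective number := by
  intro c
  induction c with
  | zero | succ | left | right | oracle =>
    intro d h
    cases d <;> first | rfl | (simp only [number] at h; omega)
  | pair a b iha ihb | comp a b iha ihb | prec a b iha ihb =>
    intro d h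
    cases d <;> simp only [number] at h <;> try omega
    rename_i a' b'
    obtain ⟨h₁, h₂⟩ : a.number = a'.number ∧ b.number = b'.number :=
      Nat.pair_eq_pair.mp (by omega)
    rw [iha h₁, ihb h₂]
  | rfind a iha =>
    intro d h
    cases d <;> simp only [number] at h <;> try omega
    rename_i a'
    rw [iha (show a.number = a'.number by omega)]

instance : Countable OracleCode := OracleCode.number_injective.countable

lemma OracleCode.Maps.unique {c : OracleCode} {g f f' : ℕ → ℕ} (h : c.Maps g f)
    (h' : c.Maps g f') : f = f' :=
  funext fun n => Part.mem_unique (h n) (h' n)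

/-! ### Turing reducibility -/

/-- `f` is Turing reducible to `g`. -/
def ComputableFrom (f g : ℕ → ℕ) : Prop := ∃ c : OracleCode, c.Maps g f

lemma ComputableFrom.trans {f g h : ℕ → ℕ} (hfg : ComputableFrom f g)
    (hgh : ComputableFrom g h) : ComputableFrom f h := by
  obtain ⟨c, hc⟩ := hfg
  obtain ⟨d, hd⟩ := hgh
  exact ⟨.subst d c, fun n => by rw [OracleCode.eval_subst hd]; exact hc n⟩

lemma computableFrom_refl (f : ℕ → ℕ) : ComputableFrom f f :=
  ⟨.oracle, fun _ => Part.mem_some _⟩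

lemma computableFrom_of_computable {f : ℕ → ℕ} (hf : Computable f) (g : ℕ → ℕ) :
    ComputableFrom f g := by
  obtain ⟨c, hc⟩ := OracleCode.exists_of_computable hf
  exact ⟨c, fun n => by rw [hc]; exact Part.mem_some _⟩

/-- Only countably many functions are computable from `g`. -/
lemma exists_not_computableFrom (g : ℕ → ℕ) : ∃ f, ¬ ComputableFrom f g := by
  by_contra! h
  choose c hc using h
  -- With the oracle fixed, a code yields at most one total function. So `ℕ → ℕ` would be countable,
  -- and Cantor's diagonal applies.
  have hinj : Function.Injective c := fun f f' e => (hc f).unique (e ▸ hc f')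
  have := hinj.countable
  obtain ⟨e, he⟩ := exists_surjective_nat (ℕ → ℕ)
  obtain ⟨k, hk⟩ := he fun n => e n n + 1
  exact absurd (congrFun hk k) (by simp)

/-! ### Joins of mass problems -/

lemma joinFun_comp_even (f g : ℕ → ℕ) (n : ℕ) : joinFun f g (2 * n) = f n := by
  simp [joinFun]

lemma joinFun_comp_odd (f g : ℕ → ℕ) (n : ℕ) : joinFun f g (2 * n + 1) = g n := by
  have h₁ : (2 * n + 1) % 2 = 1 := by omega
  have h₂ : (2 * n + 1) / 2 = n := by omega
  simp [joinFun, h₁, h₂]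

/-- Two functionals can be merged into one that computes the join of their values. -/
lemma OracleCode.exists_joinFun (a b : OracleCode) : ∃ c : OracleCode, ∀ g u v,
    a.Maps g u → b.Maps g v → c.Maps g (joinFun u v) := by
  obtain ⟨h, hh⟩ := exists_of_computable (f := fun n => n / 2)
    (Primrec.nat_div.comp Primrec.id (Primrec.const 2)).to_comp
  -- On input `⟨n, ⟨x, y⟩⟩` this selects `x` or `y` by the parity of `n`. Both functionals may be
  -- run at `n / 2` whatever the parity, since both are total on `g`.
  obtain ⟨s, hs⟩ := exists_of_computable
    (f := fun n => if n.unpair.1 % 2 = 0 then n.unpair.2.unpair.1 else n.unpair.2.unpair.2)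
    (Primrec.ite
      (Primrec.eq.comp (Primrec.nat_mod.comp (Primrec.fst.comp Primrec.unpair) (Primrec.const 2))
        (Primrec.const 0))
      (Primrec.fst.comp (Primrec.unpair.comp (Primrec.snd.comp Primrec.unpair)))
      (Primrec.snd.comp (Primrec.unpair.comp (Primrec.snd.comp Primrec.unpair)))).to_comp
  refine ⟨.comp s (.pair ident (.pair (.comp a h) (.comp b h))), fun g u v hu hv n => ?_⟩
  have ha := Part.eq_some_iff.mpr (hu (n / 2))
  have hb := Part.eq_some_iff.mpr (hv (n / 2))
  have ha' : (OracleCode.comp a h).eval g n = Part.some (u (n / 2)) := by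
    rw [eval_comp (hh g n), ha]
  have hb' : (OracleCode.comp b h).eval g n = Part.some (v (n / 2)) := by
    rw [eval_comp (hh g n), hb]
  rw [eval_comp (eval_pair (eval_ident g n) (eval_pair ha' hb')), hs]
  simp [joinFun]

lemma ComputableFrom.joinFun {f g h : ℕ → ℕ} (hf : ComputableFrom f h)
    (hg : ComputableFrom g h) : ComputableFrom (joinFun f g) h := by
  obtain ⟨a, ha⟩ := hf
  obtain ⟨b, hb⟩ := hg
  obtain ⟨c, hc⟩ := OracleCode.exists_joinFun a b
  exact ⟨c, hc h f g ha hb⟩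

lemma medvedevLE_of_subset {A B : MassProblem} (h : B ⊆ A) : MedvedevLE A B :=
  ⟨.oracle, fun g hg => ⟨g, h hg, fun _ => Part.mem_some _⟩⟩

lemma medvedevLE_join_left (A B : MassProblem) : MedvedevLE A (join A B) := by
  obtain ⟨e, he⟩ := OracleCode.exists_of_computable (f := fun n => 2 * n)
    (Primrec.nat_mul.comp (Primrec.const 2) Primrec.id).to_comp
  refine ⟨.comp .oracle e, ?_⟩
  rintro _ ⟨f, hf, g, -, rfl⟩
  exact ⟨f, hf, fun n => by simp [OracleCode.eval, he, joinFun_comp_even]⟩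

lemma medvedevLE_join_right (A B : MassProblem) : MedvedevLE B (join A B) := by
  obtain ⟨e, he⟩ := OracleCode.exists_of_computable (f := fun n => 2 * n + 1)
    (Primrec.succ.comp (Primrec.nat_mul.comp (Primrec.const 2) Primrec.id)).to_comp
  refine ⟨.comp .oracle e, ?_⟩
  rintro _ ⟨f, -, g, hg, rfl⟩
  exact ⟨g, hg, fun n => by simp [OracleCode.eval, he, joinFun_comp_odd]⟩

lemma join_medvedevLE {A B C : MassProblem} (hA : MedvedevLE A C) (hB : MedvedevLE B C) :
    MedvedevLE (join A B) C := by
  obtain ⟨a, ha⟩ := hA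
  obtain ⟨b, hb⟩ := hB
  obtain ⟨c, hc⟩ := OracleCode.exists_joinFun a b
  refine ⟨c, fun g hg => ?_⟩
  obtain ⟨u, hu, hau⟩ := ha g hg
  obtain ⟨v, hv, hbv⟩ := hb g hg
  exact ⟨_, ⟨u, hu, v, hv, rfl⟩, hc g u v hau hbv⟩

lemma join_medvedevLE_iff {A B C : MassProblem} :
    MedvedevLE (join A B) C ↔ MedvedevLE A C ∧ MedvedevLE B C :=
  ⟨fun h => ⟨(medvedevLE_join_left A B).trans h, (medvedevLE_join_right A B).trans h⟩,
    fun h => join_medvedevLE h.1 h.2⟩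

/-! ### The interval -/

/-- The functions that are not computable. -/
def noncomputableFunctions : MassProblem := {h | ¬ ComputableFrom h 0}

/-- The functions that are not computable from `f`. -/
def notBelow (f : ℕ → ℕ) : MassProblem := {h | ¬ ComputableFrom h f}

lemma notBelow_subset (f : ℕ → ℕ) : notBelow f ⊆ noncomputableFunctions :=
  fun _ hh h0 => hh (h0.trans (computableFrom_of_computable (Computable.const 0) f))

/-- Whatever a functional outputs on `b` is computable from `b`, hence from `f`. -/
lemma not_notBelow_medvedevLE {f b : ℕ → ℕ} {B : MassProblem} (hb : b ∈ B)
    (hbf : ComputableFrom b f) : ¬ MedvedevLE (notBelow f) B := by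
  rintro ⟨c, hc⟩
  obtain ⟨h, hh, hm⟩ := hc b hb
  exact hh (ComputableFrom.trans ⟨c, hm⟩ hbf)

/-- A mass problem with a solution computable from `f` is of no help in solving `notBelow f`. -/
lemma notBelow_medvedevLE_of_join {f b : ℕ → ℕ} {B C : MassProblem} (hb : b ∈ B)
    (hbf : ComputableFrom b f) (h : MedvedevLE (notBelow f) (join B C)) :
    MedvedevLE (notBelow f) C := by
  -- The identity reduces: a `g ∈ C` computable from `f` would make `b ⊕ g` a member of the join
  -- computable from `f`.
  refine medvedevLE_of_subset fun g hg hgf => ?_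
  have hbg : joinFun b g ∈ join B C := ⟨b, hb, g, hg, rfl⟩
  exact not_notBelow_medvedevLE hbg (hbf.joinFun hgf) h

/-- A noncomputable function. -/
noncomputable def someNoncomputable : ℕ → ℕ := (exists_not_computableFrom 0).choose

lemma someNoncomputable_mem : someNoncomputable ∈ noncomputableFunctions :=
  (exists_not_computableFrom 0).choose_spec

/-- The interval with the trivial mass problem as `B₋₁`, the noncomputable functions as every
`B i`, and the functions not computable from a fixed noncomputable function as `A`. -/
noncomputable def markovInterval : Interval where
  A := notBelow someNoncomputable
  B0 := Set.univ
  B _ := noncomputableFunctions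
  B_le_A := ⟨.comp .oracle .succ, fun _ g hg =>
    ⟨g, notBelow_subset _ hg, fun n => by simp [OracleCode.eval, cons]⟩⟩
  B0_le_B := ⟨.comp .oracle .succ, fun _ g _ =>
    ⟨g, Set.mem_univ g, fun n => by simp [OracleCode.eval, cons]⟩⟩
  B0_not_ge := not_notBelow_medvedevLE (Set.mem_univ _) (computableFrom_refl _)
  B_not_ge _ := not_notBelow_medvedevLE someNoncomputable_mem (computableFrom_refl _)

lemma markovInterval_bottomAt_le (n : ℕ) (y : Fin n → ℕ) :
    MedvedevLE (markovInterval.bottomAt n y) markovInterval.A := by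
  induction n with
  | zero => exact medvedevLE_of_subset (Set.subset_univ _)
  | succ n ih => exact join_medvedevLE (medvedevLE_of_subset (notBelow_subset _)) (ih _)

/-- The fixed noncomputable function solves every `B i` and `B₋₁`, so joins of its copies work. This
makes all least elements useless for solving `A`. -/
lemma markovInterval_exists_mem_bottomAt (n : ℕ) (y : Fin n → ℕ) :
    ∃ b ∈ markovInterval.bottomAt n y, ComputableFrom b someNoncomputable := by
  induction n with
  | zero => exact ⟨_, Set.mem_univ _, computableFrom_refl _⟩
  | succ n ih =>
    obtain ⟨b, hb, hbf⟩ := ih fun i => y i.succ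
    exact ⟨_, ⟨_, someNoncomputable_mem, b, hb, rfl⟩, (computableFrom_refl _).joinFun hbf⟩

/-! ### The structure -/

/-- The object `{1}`. -/
abbrev oneObj : Obj := ⟨.finite 0, 1⟩

instance (n : ℕ) : Unique (oneObj.pow n).Pt where
  default := fun _ => (0 : Fin 1)
  uniq _ := funext fun _ => Subsingleton.elim (α := Fin 1) _ _

/-- The only component of a family over `{1}ⁿ`. -/
def value {n : ℕ} (C : (oneObj.pow n).Fam) : MassProblem := C default

lemma value_medvedevLE {n : ℕ} (C : (oneObj.pow n).Fam) (p : (oneObj.pow n).Pt) :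
    MedvedevLE (C p) (value C) := by
  rw [Unique.eq_default p]
  exact MedvedevLE.refl _

lemma le_iff_value {n : ℕ} {C D : (oneObj.pow n).Fam} :
    C ≤ D ↔ MedvedevLE (value C) (value D) :=
  ⟨fun h => h default, fun h p => by rw [Unique.eq_default p]; exact h⟩

/-- The structure with universe `{1}` that interprets `S` by the bottom element. -/
noncomputable abbrev markovStruct : Struct markovInterval unaryLang where
  univ := oneObj
  fn f := nomatch f
  fn_morphism f := nomatch f
  rel _ := ⟨_, le_rfl, fun _ => markovInterval_bottomAt_le _ _⟩

/-- The algebra of `{1}ⁿ`. -/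
abbrev MarkovPred (n : ℕ) : Type := markovInterval.Pred (oneObj.pow n)

instance (n : ℕ) : OrderBot (MarkovPred n) where
  bot := ⟨_, le_rfl, fun _ => markovInterval_bottomAt_le _ _⟩
  bot_le a := a.2.1

instance (n : ℕ) : OrderTop (MarkovPred n) where
  top := ⟨_, fun _ => markovInterval_bottomAt_le _ _, le_rfl⟩
  le_top a := a.2.2

/-- All points are equal, so pulling back merely joins the least element of the larger power. -/
lemma value_pull_dropLast {n : ℕ} (d : MarkovPred n) :
    value (n := n + 1) (markovInterval.pull (oneObj.dropLast n) d.1) =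
      join (value d.1) (value (⊥ : MarkovPred (n + 1)).1) := by
  show join (d.1 _) _ = join (d.1 _) _
  rw [Subsingleton.elim (oneObj.dropLast n default) default]
  rfl

lemma MarkovPred.coe_le {n : ℕ} {a b : MarkovPred n} (h : a ≤ b) : a.1 ≤ b.1 := h

/-- The two exponents are independent because the top is `A` over every power; the universal
quantifier needs them to differ. -/
lemma top_le_of_le_join {n m : ℕ} {a : MarkovPred n} (ha : IsBot a) {Y : MassProblem}
    (h : MedvedevLE (value (⊤ : MarkovPred m).1) (join (value a.1) Y)) :
    MedvedevLE (value (⊤ : MarkovPred m).1) Y := by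
  obtain ⟨b, hb, hbf⟩ := markovInterval_exists_mem_bottomAt (oneObj.pow n).exp
    fun i => (oneObj.pow n).base.toNat ((default : (oneObj.pow n).Pt) i)
  have h₁ : MedvedevLE (value a.1) (value (⊥ : MarkovPred n).1) := le_iff_value.mp (ha ⊥)
  refine notBelow_medvedevLE_of_join hb hbf (h.trans ?_)
  exact join_medvedevLE (h₁.trans (medvedevLE_join_left _ _)) (medvedevLE_join_right _ _)

lemma isBot_iff_le_bot {n : ℕ} {a : MarkovPred n} : IsBot a ↔ a ≤ ⊥ :=
  ⟨fun h => h ⊥, fun h _ => h.trans bot_le⟩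

lemma isTop_iff_top_le {n : ℕ} {a : MarkovPred n} : IsTop a ↔ ⊤ ≤ a :=
  ⟨fun h => h ⊤, fun h _ => le_top.trans h⟩

/-- A least `a` can be cancelled from `A ≤ a ⊕ y`, so only a largest `y` satisfies the condition. -/
lemma isTop_iff_of_imp {n : ℕ} {a b c : MarkovPred n} (ha : IsBot a) (hb : IsTop b) :
    (∀ y : MarkovPred n, c ≤ y ↔ b.1 ≤ a.1.join y.1) ↔ IsTop c := by
  have key : ∀ y : MarkovPred n, b.1 ≤ a.1.join y.1 ↔ ⊤ ≤ y := by
    refine fun y => ⟨fun h => ?_, fun h => ?_⟩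
    · exact le_iff_value.mpr (top_le_of_le_join ha
        (le_iff_value.mp ((MarkovPred.coe_le (hb ⊤)).trans h)))
    · refine (MarkovPred.coe_le (le_top.trans h)).trans (le_iff_value.mpr ?_)
      exact medvedevLE_join_right _ _
  simp only [key]
  exact ⟨fun h => isTop_iff_top_le.mpr ((h c).mp le_rfl),
    fun h y => ⟨fun hy => (h ⊤).trans hy, fun hy => le_top.trans hy⟩⟩

lemma isBot_iff_of_imp_top {n : ℕ} {a b c : MarkovPred n} (ha : IsTop a) :
    (∀ y : MarkovPred n, c ≤ y ↔ b.1 ≤ a.1.join y.1) ↔ IsBot c := by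
  have key : ∀ y : MarkovPred n, b.1 ≤ a.1.join y.1 := fun y =>
    (MarkovPred.coe_le (ha b)).trans (le_iff_value.mpr (medvedevLE_join_left _ _))
  simp only [key, iff_true]
  rfl

/-! ### Values of the subformulas. -/

lemma interprets_neg_iff_of_isBot {n : ℕ} {φ : Formula unaryLang n}
    (h : ∀ c, markovStruct.Interprets φ c ↔ IsBot c) (c : MarkovPred n) :
    markovStruct.Interprets φ.neg c ↔ IsTop c := by
  constructor
  · rintro ⟨a, b, ha, hb, hc⟩
    exact (isTop_iff_of_imp ((h a).mp ha) hb).mp hc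
  · exact fun hc => ⟨(⊥ : MarkovPred n), (⊤ : MarkovPred n), (h _).mpr isBot_bot, isTop_top,
      (isTop_iff_of_imp isBot_bot isTop_top).mpr hc⟩

lemma interprets_neg_iff_of_isTop {n : ℕ} {φ : Formula unaryLang n}
    (h : ∀ c, markovStruct.Interprets φ c ↔ IsTop c) (c : MarkovPred n) :
    markovStruct.Interprets φ.neg c ↔ IsBot c := by
  constructor
  · rintro ⟨a, b, ha, hb, hc⟩
    exact (isBot_iff_of_imp_top ((h a).mp ha)).mp hc
  · exact fun hc => ⟨(⊤ : MarkovPred n), (⊤ : MarkovPred n), (h _).mpr isTop_top, isTop_top,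
      (isBot_iff_of_imp_top isTop_top).mpr hc⟩

lemma interprets_formulaS_iff (c : MarkovPred 1) :
    markovStruct.Interprets formulaS c ↔ IsBot c := by
  -- The pullback is the least element joined with itself.
  have hle : markovInterval.pull (fun p => markovStruct.univ.tuple fun i =>
      markovStruct.termVal p (.var 0)) (markovStruct.rel UnaryRel.S).1 ≤ (⊥ : MarkovPred 1).1 := by
    refine le_iff_value.mpr (join_medvedevLE ?_ (MedvedevLE.refl _))
    exact value_medvedevLE (⊥ : MarkovPred 1).1 _
  constructor
  · exact fun h => isBot_iff_le_bot.mpr (h.1.trans hle)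
  · refine fun h => ⟨(MarkovPred.coe_le (h ⊥)).trans ?_,
      hle.trans (MarkovPred.coe_le bot_le)⟩
    exact le_iff_value.mpr (medvedevLE_join_right _ _)

lemma interprets_or_iff {n : ℕ} {φ ψ : Formula unaryLang n}
    (hφ : ∀ c, markovStruct.Interprets φ c ↔ IsBot c)
    (hψ : ∀ c, markovStruct.Interprets ψ c ↔ IsTop c) (c : MarkovPred n) :
    markovStruct.Interprets (φ.or ψ) c ↔ IsBot c := by
  constructor
  · rintro ⟨a, b, ha, hb, hc⟩ y
    exact (hc.1 (Set.mem_insert _ _)).trans ((hφ a).mp ha y)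
  · refine fun hc => ⟨(⊥ : MarkovPred n), (⊤ : MarkovPred n), (hφ _).mpr isBot_bot,
      (hψ _).mpr isTop_top, fun y _ => hc y, fun y hy => ?_⟩
    exact (hy (Set.mem_insert _ _)).trans bot_le

lemma interprets_and_iff {n : ℕ} {φ ψ : Formula unaryLang n}
    (hφ : ∀ c, markovStruct.Interprets φ c ↔ IsBot c)
    (hψ : ∀ c, markovStruct.Interprets ψ c ↔ IsBot c) (c : MarkovPred n) :
    markovStruct.Interprets (φ.and ψ) c ↔ IsBot c := by
  constructor
  · rintro ⟨a, b, ha, hb, hc⟩ y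
    refine hc.2 ?_
    rintro _ (rfl | rfl)
    exacts [(hφ _).mp ha y, (hψ _).mp hb y]
  · refine fun hc => ⟨(⊥ : MarkovPred n), (⊥ : MarkovPred n), (hφ _).mpr isBot_bot,
      (hψ _).mpr isBot_bot, ?_, fun y _ => hc y⟩
    rintro _ (rfl | rfl) <;> exact bot_le

/-- Every pullback has the least element as a join component, so the adjunction condition holds for
all `d`. -/
lemma interprets_all_iff_of_isBot {n : ℕ} {φ : Formula unaryLang (n + 1)}
    (hφ : ∀ c, markovStruct.Interprets φ c ↔ IsBot c) (c : MarkovPred n) :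
    markovStruct.Interprets φ.all c ↔ IsBot c := by
  have key : ∀ a : MarkovPred (n + 1), IsBot a → ∀ d : MarkovPred n,
      a.1 ≤ markovInterval.pull (oneObj.dropLast n) d.1 := fun a ha d => by
    refine (MarkovPred.coe_le (ha ⊥)).trans (le_iff_value.mpr ?_)
    exact medvedevLE_join_right _ _
  constructor
  · rintro ⟨a, ha, hc⟩ d
    exact (hc d).mpr (key a ((hφ a).mp ha) d)
  · exact fun hc => ⟨(⊥ : MarkovPred (n + 1)), (hφ _).mpr isBot_bot,
      fun d => iff_of_true (hc d) (key _ isBot_bot d)⟩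

/-- The least element added by the pullback can be cancelled, so `π*(d)` is largest only if `d` is.
-/
lemma interprets_all_iff_of_isTop {n : ℕ} {φ : Formula unaryLang (n + 1)}
    (hφ : ∀ c, markovStruct.Interprets φ c ↔ IsTop c) (c : MarkovPred n) :
    markovStruct.Interprets φ.all c ↔ IsTop c := by
  have key : ∀ a : MarkovPred (n + 1), IsTop a → ∀ d : MarkovPred n,
      a.1 ≤ markovInterval.pull (oneObj.dropLast n) d.1 ↔ ⊤ ≤ d := fun a ha d => by
    constructor
    · intro h
      have h' := le_iff_value.mp ((MarkovPred.coe_le (ha ⊤)).trans h)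
      rw [value_pull_dropLast] at h'
      refine le_iff_value.mpr (top_le_of_le_join (isBot_bot (α := MarkovPred (n + 1)))
        (h'.trans ?_))
      exact join_medvedevLE (medvedevLE_join_right _ _) (medvedevLE_join_left _ _)
    · intro h
      refine (MarkovPred.coe_le (le_top (a := a))).trans (le_iff_value.mpr ?_)
      rw [value_pull_dropLast]
      exact MedvedevLE.trans (le_iff_value (n := n).mp h) (medvedevLE_join_left _ _)
  constructor
  · rintro ⟨a, ha, hc⟩
    exact isTop_iff_top_le.mpr ((key a ((hφ a).mp ha) c).mp ((hc c).mp le_rfl))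
  · refine fun hc => ⟨(⊤ : MarkovPred (n + 1)), (hφ _).mpr isTop_top, fun d => ?_⟩
    rw [key _ isTop_top]
    exact ⟨fun h => (hc ⊤).trans h, fun h => le_top.trans h⟩

/-- The bottom element over `{1}`, viewed as an element of the algebra of `{1}⁰`. -/
noncomputable def bottomOne : MarkovPred 0 :=
  ⟨fun _ => value (⊥ : MarkovPred 1).1,
    le_iff_value.mpr (medvedevLE_of_subset (Set.subset_univ _)),
    le_iff_value.mpr (markovInterval_bottomAt_le _ _)⟩

lemma not_isBot_bottomOne : ¬ IsBot bottomOne := by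
  intro h
  obtain ⟨c, hc⟩ := (medvedevLE_join_left noncomputableFunctions Set.univ).trans
    (le_iff_value.mp (h ⊥))
  -- The zero function solves `B₋₁`; a reduction would compute a noncomputable function from it.
  obtain ⟨f, hf, hm⟩ := hc 0 (Set.mem_univ _)
  exact hf ⟨c, hm⟩

/-- In `d ⊕ B₁ ≤ B₁` the second component is free, leaving `d ≤ B₁`. The right adjoint therefore
carries the least element over `{1}` down unchanged. -/
lemma interprets_ex_iff {φ : Formula unaryLang 1}
    (hφ : ∀ c, markovStruct.Interprets φ c ↔ IsBot c) (c : MarkovPred 0) :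
    markovStruct.Interprets φ.ex c ↔ AntisymmRel (· ≤ ·) c bottomOne := by
  have key : ∀ a : MarkovPred 1, IsBot a → ∀ d : MarkovPred 0,
      markovInterval.pull (oneObj.dropLast 0) d.1 ≤ a.1 ↔ d ≤ bottomOne := fun a ha d => by
    have h₁ : MedvedevLE (value a.1) (value (⊥ : MarkovPred 1).1) := le_iff_value.mp (ha ⊥)
    have h₂ : MedvedevLE (value (⊥ : MarkovPred 1).1) (value a.1) :=
      le_iff_value.mp (bot_le (a := a))
    refine Iff.trans (le_iff_value (n := 1)) (Iff.trans ?_ (le_iff_value (n := 0)).symm)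
    rw [value_pull_dropLast, join_medvedevLE_iff]
    exact ⟨fun h => h.1.trans h₁, fun h => ⟨MedvedevLE.trans h h₂, h₂⟩⟩
  constructor
  · rintro ⟨a, ha, hc⟩
    have hc' := fun d => (hc d).trans (key a ((hφ a).mp ha) d)
    exact ⟨(hc' c).mp le_rfl, (hc' bottomOne).mpr le_rfl⟩
  · refine fun hc => ⟨(⊥ : MarkovPred 1), (hφ _).mpr isBot_bot, fun d => ?_⟩
    rw [key _ isBot_bot]
    exact ⟨fun h => h.trans hc.1, fun h => h.trans hc.2⟩

/-- Joining a least premise to `y` leaves the degree of `y` unchanged, so the implication has the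
value of its conclusion. -/
lemma interprets_imp_iff {n : ℕ} {φ ψ : Formula unaryLang n} {e : MarkovPred n}
    (hφ : ∀ c, markovStruct.Interprets φ c ↔ IsBot c)
    (hψ : ∀ c, markovStruct.Interprets ψ c ↔ AntisymmRel (· ≤ ·) c e) (c : MarkovPred n) :
    markovStruct.Interprets (φ.imp ψ) c ↔ AntisymmRel (· ≤ ·) c e := by
  have key : ∀ a b : MarkovPred n, IsBot a → ∀ y : MarkovPred n,
      b.1 ≤ a.1.join y.1 ↔ b ≤ y := fun a b ha y => by
    constructor
    · refine fun h => h.trans (le_iff_value.mpr ?_)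
      exact join_medvedevLE (le_iff_value.mp (ha y)) (MedvedevLE.refl _)
    · refine fun h => (show b.1 ≤ y.1 from h).trans (le_iff_value.mpr ?_)
      exact medvedevLE_join_right _ _
  constructor
  · rintro ⟨a, b, ha, hb, hc⟩
    have hc' := fun y => (hc y).trans (key a b ((hφ a).mp ha) y)
    have hbe := (hψ b).mp hb
    exact ⟨((hc' b).mpr le_rfl).trans hbe.1, hbe.2.trans ((hc' c).mp le_rfl)⟩
  · refine fun hc => ⟨(⊥ : MarkovPred n), e, (hφ _).mpr isBot_bot, (hψ _).mpr ⟨le_rfl, le_rfl⟩,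
      fun y => ?_⟩
    rw [key _ _ isBot_bot]
    exact ⟨fun h => hc.2.trans h, fun h => hc.1.trans h⟩

lemma interprets_markovSentence_iff (c : MarkovPred 0) :
    markovStruct.Interprets markovSentence c ↔ AntisymmRel (· ≤ ·) c bottomOne := by
  have hS := interprets_formulaS_iff
  have hneg := interprets_neg_iff_of_isBot hS
  exact interprets_imp_iff
    (interprets_and_iff (interprets_all_iff_of_isBot (interprets_or_iff hS hneg))
      (interprets_neg_iff_of_isTop (interprets_all_iff_of_isTop hneg)))
    (interprets_ex_iff (interprets_neg_iff_of_isTop hneg)) c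

end MassProb

theorem mainTheorem12 :
    ∃ (I : MassProb.Interval) (M : MassProb.Struct I MassProb.unaryLang),
      M.Refutes MassProb.markovSentence := by
  refine ⟨MassProb.markovInterval, MassProb.markovStruct, ⟨MassProb.bottomOne, ?_⟩, fun c hc h => ?_⟩
  · exact (MassProb.interprets_markovSentence_iff _).mpr ⟨le_rfl, le_rfl⟩
  · have hle := ((MassProb.interprets_markovSentence_iff c).mp hc).2
    exact MassProb.not_isBot_bottomOne fun d => hle.trans (h d)
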